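/- Let $\mathbb{K}$ be a field, $R=\mathbb{K}[x_0,x_1,x_2]$, and let $\mathcal{F}:\mathbb{P}^2_{\mathbb K}\dashrightarrow\mathbb{P}^2_{\mathbb K}$ be a dominant rational map defined by forms $f_0,f_1,f_2\in R$ of the same degree $d\ge 3$. Assume that the base ideal $I=(f_0,f_1,f_2)$ is saturated with respect to $(x_0,x_1,x_2)$ and that $\dim(R/I)=1$. Let $\varphi$ be the $3\times 2$ matrix of a graded (Hilbert--Burch) presentation $$0\to R(-d-\mu_1)\oplus R(-d-\mu_2)\xrightarrow{\ \varphi\ }R(-d)^3\xrightarrow{(f_0,f_1,f_2)} I\to 0,\qquad \mu_1+\mu_2=d,\ \mu_1\le\mu_2,$$ and suppose that $\mu_1=1$. Let $I_1(\varphi)$ be the ideal generated by the entries of $\varphi$. Call a linear change of coordinates in the source and the target (replacing $\varphi$ by $P\,\varphi(Ax)$ with $A,P\in \mathrm{GL}_3(\mathbb{K})$) admissible if it brings $\varphi$ to the form $$\begin{pmatrix} x_0 & p_0\\ -x_1 & p_1\\ 0 & p_2\end{pmatrix}.$$ For a matrix of this form, the Sylvester-form algorithm works in $\mathcal{A}=R[y_0,y_1,y_2]$: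 start with $i=0$ and $F_0=p_0y_0+p_1y_1+p_2y_2$; while $F_i\in(x_0,x_1)$, write $F_i=a_ix_0+b_ix_1$ with $a_i,b_i\in\mathcal{A}$, set $$F_{i+1}=\det\begin{pmatrix} y_0&-y_1\\ a_i&b_i\end{pmatrix},$$ and increase $i$ by one. The number of steps $m$ is the first index with $F_m\notin(x_0,x_1)$. Then $\mathcal{F}$ is birational if and only if both of the following conditions hold: (i) $\operatorname{ht}(I_1(\varphi))=2$; (ii) after an admissible linear change of coordinates, the Sylvester-form algorithm takes exactly $m=d-2$ steps, whatever expressions $F_i=a_ix_0+b_ix_1$ are chosen. The equivalence holds both when (ii) is required for some admissible change of coordinates and when it is required for every admissible change of coordinates. -/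

import Mathlib

/-- The polynomial ring `R = K[x₀, x₁, x₂]`, the homogeneous coordinate ring of `ℙ²`. -/
abbrev PlaneRing (K : Type*) [Field K] := MvPolynomial (Fin 3) K

/-- The polynomial ring `𝒜 = R[y₀, y₁, y₂]`; here `y_i` is `X i` and `x_i` is `C (X i)`. -/
abbrev BiRing (K : Type*) [Field K] := MvPolynomial (Fin 3) (PlaneRing K)

namespace PlaneMap

open MvPolynomial

section
variable {K : Type*} [Field K]

/-- A rational map `ℙ² ⇢ ℙ²` given by the forms `f = (f₀ : f₁ : f₂)` of one degree is dominant when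
its image lies in no hypersurface: no nonzero polynomial in `y₀, y₁, y₂` vanishes at `f`. -/
def IsDominant (f : Fin 3 → PlaneRing K) : Prop :=
  AlgebraicIndependent K f

/-- `f` is birational: it is dominant, and some tuple `g` of forms of one degree defines an inverse
rational map, i.e. both composites are defined and are the identity of `ℙ²`:
`g(f) = D • (x₀, x₁, x₂)` and `f(g) = D' • (y₀, y₁, y₂)` with `D, D' ≠ 0`. -/
def IsBirational (f : Fin 3 → PlaneRing K) : Prop :=
  IsDominant f ∧
    ∃ (e : ℕ) (g : Fin 3 → MvPolynomial (Fin 3) K),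
      (∀ j, (g j).IsHomogeneous e) ∧
      (∃ D : PlaneRing K, D ≠ 0 ∧ ∀ j, aeval f (g j) = D * X j) ∧
      (∃ D' : MvPolynomial (Fin 3) K, D' ≠ 0 ∧ ∀ i, aeval g (f i) = D' * X i)

/-- The base ideal `I = (f₀, f₁, f₂)`. -/
noncomputable def baseIdeal (f : Fin 3 → PlaneRing K) : Ideal (PlaneRing K) :=
  Ideal.span (Set.range f)

/-- The ideal `𝔪 = (x₀, x₁, x₂)`. -/
noncomputable def irrelevantIdeal (K : Type*) [Field K] : Ideal (PlaneRing K) :=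
  Ideal.span (Set.range X)

/-- `I` is saturated: `(I : 𝔪^∞) = I`. -/
def IsSaturated (I : Ideal (PlaneRing K)) : Prop :=
  ∀ (p : PlaneRing K) (n : ℕ), (∀ q ∈ irrelevantIdeal K ^ n, q * p ∈ I) → p ∈ I

/-- `φ` is the matrix of a graded presentation
`0 → R(-d-μ₁) ⊕ R(-d-μ₂) → R(-d)³ → I → 0` of the ideal generated by the forms `f` of degree `d`,
where `μ₁ + μ₂ = d` and `μ₁ ≤ μ₂`. -/
structure IsHilbertBurch (f : Fin 3 → PlaneRing K) (d μ₁ μ₂ : ℕ)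
    (φ : Matrix (Fin 3) (Fin 2) (PlaneRing K)) : Prop where
  sum_eq : μ₁ + μ₂ = d
  le : μ₁ ≤ μ₂
  homogeneous₁ : ∀ i, (φ i 0).IsHomogeneous μ₁
  homogeneous₂ : ∀ i, (φ i 1).IsHomogeneous μ₂
  injective : Function.Injective φ.mulVec
  exact : ∀ v : Fin 3 → PlaneRing K, ∑ i, f i * v i = 0 ↔ ∃ u : Fin 2 → PlaneRing K, φ.mulVec u = v

/-- `I₁(φ)`, the ideal generated by the entries of `φ`. -/
noncomputable def entryIdeal (φ : Matrix (Fin 3) (Fin 2) (PlaneRing K)) : Ideal (PlaneRing K) :=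
  Ideal.span (Set.range fun ij : Fin 3 × Fin 2 => φ ij.1 ij.2)

/-- The linear substitution `x_i ↦ ∑ j, A i j * x_j` in the source. -/
noncomputable def substSource (A : GL (Fin 3) K) : PlaneRing K →ₐ[K] PlaneRing K :=
  aeval fun i => ∑ j, C (A.val i j) * X j

/-- The presentation matrix after linear changes of coordinates in source and target. If the row
`f` of forms satisfies `f φ = 0`, then the row `f(A x) P⁻¹`, which is `f` after the change of
coordinates `A` in the source and `P` in the target, has presentation matrix `P φ(A x)`. -/
noncomputable def changeCoords (A P : GL (Fin 3) K) (φ : Matrix (Fin 3) (Fin 2) (PlaneRing K)) :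
    Matrix (Fin 3) (Fin 2) (PlaneRing K) :=
  Matrix.of fun i k => ∑ j, C (P.val i j) * substSource A (φ j k)

/-- The first column of `φ` is `(x₀, -x₁, 0)`. -/
def IsNormalForm (φ : Matrix (Fin 3) (Fin 2) (PlaneRing K)) : Prop :=
  φ 0 0 = X 0 ∧ φ 1 0 = -X 1 ∧ φ 2 0 = 0

/-- The polynomial `g₂`, second entry of the row `(y₀, y₁, y₂) φ`. -/
noncomputable def secondEquation (φ : Matrix (Fin 3) (Fin 2) (PlaneRing K)) : BiRing K :=
  ∑ i, X i * C (φ i 1)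

/-- The ideal `(x₀, x₁)` of `𝒜`. -/
noncomputable def axisIdeal (K : Type*) [Field K] : Ideal (BiRing K) :=
  Ideal.span {C (X 0), C (X 1)}

/-- `F 0, …, F m` is a complete run of the algorithm of Sylvester forms on a matrix `φ` with first
column `(x₀, -x₁, 0)`. It starts at `F 0 = g₂`; while `F i` lies in `(x₀, x₁)`, one writes
`F i = a x₀ + b x₁` and sets `F (i+1) = det (y₀, -y₁; a, b)`; it stops at the first `F m` outside
`(x₀, x₁)`. (The values of `F` beyond `m` play no role.) -/
def IsSylvesterRun (φ : Matrix (Fin 3) (Fin 2) (PlaneRing K)) (F : ℕ → BiRing K) (m : ℕ) : Prop :=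
  F 0 = secondEquation φ ∧
    (∀ i < m, ∃ a b : BiRing K,
      F i = a * C (X 0) + b * C (X 1) ∧ F (i + 1) = Matrix.det !![X 0, -X 1; a, b]) ∧
    F m ∉ axisIdeal K

/-- The algorithm of Sylvester forms, applied to `φ`, takes exactly `m` steps: it can be run to its
end, and every complete run, whatever expressions `F i = a x₀ + b x₁` are chosen, has `m` steps. -/
def SylvesterSteps (φ : Matrix (Fin 3) (Fin 2) (PlaneRing K)) (m : ℕ) : Prop :=
  (∃ F, IsSylvesterRun φ F m) ∧ ∀ F n, IsSylvesterRun φ F n → n = m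

end

end PlaneMap

/-!
After a linear change of coordinates, the linear column of `φ` is either `(x₀, -x₁, 0)` or
`(x₀, x₁, x₂)`. In the first case the linear syzygy says that `y = f(x)` satisfies `y₀ x₀ = y₁ x₁`,
so the fibre over `y` lies on the line of the points `(y₁ : y₀ : s)`, and the second column cuts it
out there by one polynomial in `s`. An inverse of `f` gives a relation linear in `s` that this
polynomial divides: seen from the source, it is a linear equation in `y₂`, which is prime because
its coefficients have no common factor by Hilbert–Burch. So it has degree one in `s`. Conversely, a
linear equation is solved for `s`, which inverts `f`. Setting
`(x₀, x₁) = t (y₁, y₀)` in the second equation, one step of the algorithm of Sylvester forms divides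
by `t`; the number of steps is therefore the order of vanishing in `t`, that is, `μ₂` minus the
degree in `s`. In the second case a similar argument on the line `y · x = 0` excludes birationality,
and the entries of `φ` generate an ideal of height three.
-/

namespace PlaneMap

open MvPolynomial Matrix

section CommonFactors

variable {R : Type*} [CommRing R] {ι : Type*} {v w : ι → R}

/-- The entries of `v` have no common factor: each of their common divisors is a unit. For two
entries this is `IsRelPrime`. -/
def HasNoCommonFactor (v : ι → R) : Prop :=
  ∀ e, (∀ i, e ∣ v i) → IsUnit e

theorem HasNoCommonFactor.ne_zero [Nontrivial R] (hv : HasNoCommonFactor v) : v ≠ 0 := by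
  rintro rfl
  exact not_isUnit_zero (hv 0 fun _ => dvd_rfl)

theorem HasNoCommonFactor.units_smul (hv : HasNoCommonFactor v) (c : Rˣ) :
    HasNoCommonFactor (c • v) :=
  fun e he => hv e fun i => (c.isUnit.dvd_mul_left).1 (he i)

variable [IsGCDMonoid R] [Finite ι]

theorem HasNoCommonFactor.dvd_of_forall_dvd_mul (hv : HasNoCommonFactor v) {a b : R}
    (h : ∀ i, a ∣ b * v i) : a ∣ b := by
  cases nonempty_fintype ι
  obtain ⟨_⟩ : Nonempty (NormalizedGCDMonoid R) := inferInstance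
  have hgcd : IsUnit (Finset.univ.gcd v) := hv _ fun i => Finset.gcd_dvd (Finset.mem_univ i)
  have hab : a ∣ b * Finset.univ.gcd v :=
    (Finset.dvd_gcd fun i _ => h i).trans (Finset.gcd_mul_left' Finset.univ v b).dvd
  exact hgcd.dvd_mul_right.1 hab

theorem HasNoCommonFactor.exists_eq_smul [IsDomain R] (hv : HasNoCommonFactor v)
    (hvw : ∀ i j, v i * w j = v j * w i) : ∃ e : R, w = e • v := by
  obtain ⟨i, hi⟩ := Function.ne_iff.1 hv.ne_zero
  obtain ⟨e, he⟩ : v i ∣ w i :=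
    hv.dvd_of_forall_dvd_mul fun j => ⟨w j, by rw [hvw i j, mul_comm]⟩
  refine ⟨e, funext fun j => mul_left_cancel₀ hi ?_⟩
  rw [hvw i j, he, Pi.smul_apply, smul_eq_mul]
  ring

theorem exists_eq_smul_hasNoCommonFactor [Nonempty ι] (v : ι → R) :
    ∃ (c : R) (w : ι → R), v = c • w ∧ HasNoCommonFactor w := by
  cases nonempty_fintype ι
  obtain ⟨_⟩ : Nonempty (NormalizedGCDMonoid R) := inferInstance
  obtain ⟨w, hvw, hw⟩ := Finset.univ.extract_gcd v Finset.univ_nonempty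
  exact ⟨_, w, funext fun i => hvw i (Finset.mem_univ i), fun e he =>
    isUnit_of_dvd_one (hw ▸ Finset.dvd_gcd fun i _ => he i)⟩

end CommonFactors

section HilbertBurch

variable {R : Type*} [CommRing R]

theorem dvd_mul_sub_mul_of_forall_dvd_crossProduct {e : R} {v w : Fin 3 → R}
    (h : ∀ i, e ∣ (v ⨯₃ w) i) (i j : Fin 3) : e ∣ v i * w j - v j * w i := by
  have h0 := h 0
  have h1 := h 1
  have h2 := h 2
  simp only [cross_apply, cons_val] at h0 h1 h2
  fin_cases i <;> fin_cases j <;>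
    simp only [Fin.reduceFinMk, Fin.zero_eta, Fin.mk_one, sub_self, dvd_zero] <;>
    first | assumption | (rw [dvd_sub_comm]; assumption)

theorem dvd_of_forall_dvd_crossProduct {e : R} {v : Fin 3 → R} (h : ∀ w i, e ∣ (v ⨯₃ w) i)
    (i : Fin 3) : e ∣ v i := by
  have h0 := h ![0, 1, 0] 2
  have h1 := h ![0, 0, 1] 0
  have h2 := h ![1, 0, 0] 1
  simp only [cross_apply, cons_val, mul_zero, mul_one, sub_zero] at h0 h1 h2
  fin_cases i <;> assumption

/-- The row of signed maximal minors of `φ`. -/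
def minors (φ : Matrix (Fin 3) (Fin 2) R) : Fin 3 → R :=
  φ.col 0 ⨯₃ φ.col 1

theorem exists_col_crossProduct_mulVec_eq_smul_minors (φ : Matrix (Fin 3) (Fin 2) R)
    (k : Fin 2) (u : Fin 2 → R) : ∃ c : R, φ.col k ⨯₃ (φ *ᵥ u) = c • minors φ := by
  have hu : φ *ᵥ u = u 0 • φ.col 0 + u 1 • φ.col 1 := by
    ext i
    simp [mulVec, dotProduct, Fin.sum_univ_two, mul_comm]
  rw [hu, map_add, map_smul, map_smul]
  fin_cases k
  · exact ⟨u 1, by simp [minors]⟩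
  · refine ⟨-u 0, ?_⟩
    simp only [Fin.mk_one, cross_self, smul_zero, add_zero, minors]
    rw [neg_smul, ← smul_neg, cross_anticomm]

variable [IsDomain R] [IsGCDMonoid R] {f : Fin 3 → R} {φ : Matrix (Fin 3) (Fin 2) R}

/- If `f'` is the row `f` freed of its common factor, the minors are `e • f'`. Every `f' × w` is a
syzygy, hence a combination of the columns of `φ`; taking its cross product with a column shows that
`e` divides the columns, hence `f' × w` for all `w`, hence `f'`. -/
theorem exists_eq_smul_minors (hf : f ≠ 0)
    (hexact : ∀ v, f ⬝ᵥ v = 0 ↔ ∃ u, φ *ᵥ u = v) :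
    ∃ h : R, f = h • minors φ ∧ HasNoCommonFactor (minors φ) := by
  obtain ⟨h, f', rfl, hf'⟩ := exists_eq_smul_hasNoCommonFactor f
  have hh : h ≠ 0 := by rintro rfl; simp at hf
  have hcol (k : Fin 2) : f' ⬝ᵥ φ.col k = 0 := by
    have := (hexact _).2 ⟨Pi.single k 1, mulVec_single_one φ k⟩
    rw [smul_dotProduct, smul_eq_mul] at this
    exact (mul_eq_zero.1 this).resolve_left hh
  obtain ⟨e, he⟩ : ∃ e : R, minors φ = e • f' := by
    refine hf'.exists_eq_smul fun i j => sub_eq_zero.1 <| zero_dvd_iff.1 <|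
      dvd_mul_sub_mul_of_forall_dvd_crossProduct (fun k => zero_dvd_iff.2 ?_) i j
    rw [minors, cross_cross_eq_smul_sub_smul', hcol 1, dotProduct_comm, hcol 0]
    simp
  have hdvd (k : Fin 2) (i : Fin 3) : e ∣ φ i k := by
    refine hf'.dvd_of_forall_dvd_mul fun j => ?_
    obtain ⟨u, hu⟩ := (hexact (f' ⨯₃ Pi.single i 1)).1 (by simp)
    obtain ⟨c, hc⟩ := exists_col_crossProduct_mulVec_eq_smul_minors φ k u
    rw [hu, cross_cross_eq_smul_sub_smul', hcol k, he] at hc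
    exact ⟨c * f' j, by simpa [mul_left_comm] using congrFun hc j⟩
  have hunit : IsUnit e := hf' e <| dvd_of_forall_dvd_crossProduct fun w i => by
    obtain ⟨u, hu⟩ := (hexact (f' ⨯₃ w)).1 (by simp)
    rw [← hu, mulVec, dotProduct]
    exact Finset.dvd_sum fun k _ => (hdvd k i).mul_right _
  obtain ⟨e, rfl⟩ := hunit
  refine ⟨h * ↑e⁻¹, ?_, he ▸ hf'.units_smul e⟩
  rw [he, smul_smul, mul_assoc, Units.inv_mul, mul_one]

end HilbertBurch

section Presentation

variable {K : Type*} [Field K] {d μ₁ μ₂ : ℕ} {f : Fin 3 → PlaneRing K}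
  {φ : Matrix (Fin 3) (Fin 2) (PlaneRing K)}

theorem IsHilbertBurch.dotProduct_col (h : IsHilbertBurch f d μ₁ μ₂ φ) (k : Fin 2) :
    f ⬝ᵥ φ.col k = 0 :=
  (h.exact _).2 ⟨Pi.single k 1, mulVec_single_one φ k⟩

theorem IsHilbertBurch.hasNoCommonFactor_minors (h : IsHilbertBurch f d μ₁ μ₂ φ) (hf : f ≠ 0) :
    HasNoCommonFactor (minors φ) :=
  (exists_eq_smul_minors hf h.exact).choose_spec.2

end Presentation

section Evaluation

variable {K S σ : Type*} [CommRing K] [CommRing S] [Algebra K S]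

theorem aeval_smul_of_isHomogeneous {p : MvPolynomial σ K} {n : ℕ} (hp : p.IsHomogeneous n)
    (c : S) (u : σ → S) : aeval (c • u) p = c ^ n * aeval u p := by
  rw [aeval_def, aeval_def, eval₂_eq, eval₂_eq, Finset.mul_sum]
  refine Finset.sum_congr rfl fun m hm => ?_
  have hdeg : ∑ i ∈ m.support, m i = n := (hp.degree_eq_sum_deg_support hm).symm
  simp only [Pi.smul_apply, smul_eq_mul, mul_pow, Finset.prod_mul_distrib,
    Finset.prod_pow_eq_pow_sum, hdeg]
  ring

theorem dvd_aeval_sub_aeval {q : S} {u v : σ → S} (h : ∀ i, q ∣ u i - v i)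
    (p : MvPolynomial σ K) : q ∣ aeval u p - aeval v p := by
  simp only [← Ideal.mem_span_singleton, ← Ideal.Quotient.eq] at h ⊢
  have hcomp (w : σ → S) : Ideal.Quotient.mk (Ideal.span {q}) (aeval w p) =
      aeval (fun i => Ideal.Quotient.mk (Ideal.span {q}) (w i)) p :=
    comp_aeval_apply w (Ideal.Quotient.mkₐ K (Ideal.span {q})) p
  rw [hcomp, hcomp, funext h]

/- Modulo `q` the vectors `u` and `v` are proportional, so a tuple of forms takes proportional
values at them. -/
theorem dvd_mul_aeval_sub_mul_aeval_of_prime {q : S} (hq : Prime q) {u v : Fin 3 → S}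
    (huv : ∀ i, q ∣ (u ⨯₃ v) i) {k : Fin 3} (hk : ¬ q ∣ u k) {e : ℕ}
    {g₁ g₂ : MvPolynomial (Fin 3) K} (hg₁ : g₁.IsHomogeneous e) (hg₂ : g₂.IsHomogeneous e)
    {D x₁ x₂ : S} (h₁ : aeval u g₁ = D * x₁) (h₂ : aeval u g₂ = D * x₂) :
    q ∣ x₂ * aeval v g₁ - x₁ * aeval v g₂ := by
  have hform {p : MvPolynomial (Fin 3) K} (hp : p.IsHomogeneous e) :
      q ∣ u k ^ e * aeval v p - v k ^ e * aeval u p := by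
    rw [← aeval_smul_of_isHomogeneous hp, ← aeval_smul_of_isHomogeneous hp]
    refine dvd_aeval_sub_aeval (fun i => ?_) p
    rw [Pi.smul_apply, Pi.smul_apply, smul_eq_mul, smul_eq_mul, mul_comm (v k)]
    exact dvd_mul_sub_mul_of_forall_dvd_crossProduct huv k i
  refine (hq.dvd_or_dvd (?_ : q ∣ u k ^ e * _)).resolve_left (hk ∘ hq.dvd_of_dvd_pow)
  convert dvd_sub ((hform hg₁).mul_left x₂) ((hform hg₂).mul_left x₁) using 1
  rw [h₁, h₂]
  ring

end Evaluation

section Birational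

variable {K : Type*} [Field K] {f : Fin 3 → PlaneRing K} {d : ℕ}

theorem IsDominant.isBirational (hdom : IsDominant f) (hf : ∀ i, (f i).IsHomogeneous d)
    {e : ℕ} {g : Fin 3 → MvPolynomial (Fin 3) K} (hg : ∀ j, (g j).IsHomogeneous e)
    {D : PlaneRing K} (hD : D ≠ 0) (hgf : ∀ j, aeval f (g j) = D * X j) : IsBirational f := by
  refine ⟨hdom, e, g, hg, ⟨D, hD, hgf⟩, ?_⟩
  have hfg (i : Fin 3) : aeval f (aeval g (f i)) = D ^ d * f i := by
    rw [comp_aeval_apply, funext hgf]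
    exact (aeval_smul_of_isHomogeneous (hf i) D X).trans (by rw [aeval_X_left_apply])
  have hparallel (i j : Fin 3) : aeval g (f i) * X j = aeval g (f j) * X i := by
    apply show Function.Injective (aeval (R := K) f) from hdom
    simp only [map_mul, hfg, aeval_X]
    ring
  have hX : ¬ (X 0 : MvPolynomial (Fin 3) K) ∣ X 1 := by simp [X_dvd_X]
  obtain ⟨D', hD'⟩ : X 0 ∣ aeval g (f 0) :=
    (X_prime.dvd_or_dvd ⟨aeval g (f 1), by rw [hparallel 0 1, mul_comm]⟩).resolve_right hX
  have hD'X (i : Fin 3) : aeval g (f i) = D' * X i :=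
    mul_right_cancel₀ (X_ne_zero (0 : Fin 3)) (by rw [hparallel i 0, hD']; ring)
  refine ⟨D', ?_, hD'X⟩
  rintro rfl
  have h0 := hfg 0
  rw [hD'X 0, zero_mul, map_zero] at h0
  exact mul_ne_zero (pow_ne_zero d hD) (hdom.ne_zero 0) h0.symm

end Birational

section DegreeBound

variable {K : Type*} [Field K] {d μ₁ μ₂ : ℕ} {f : Fin 3 → PlaneRing K}
  {φ : Matrix (Fin 3) (Fin 2) (PlaneRing K)}

theorem IsHilbertBurch.dvd_crossProduct_of_dvd_dotProduct {S : Type*} [CommRing S]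
    [Algebra (PlaneRing K) S] (h : IsHilbertBurch f d μ₁ μ₂ φ) (hf0 : f ≠ 0) {q : S} {Y : Fin 3 → S}
    (hY₁ : (algebraMap _ S ∘ φ.col 0) ⬝ᵥ Y = 0) (hY₂ : q ∣ (algebraMap _ S ∘ φ.col 1) ⬝ᵥ Y)
    (i : Fin 3) : q ∣ ((algebraMap _ S ∘ f) ⨯₃ Y) i := by
  obtain ⟨c, hc, -⟩ := exists_eq_smul_minors hf0 h.exact
  have hmap : algebraMap _ S ∘ f = algebraMap (PlaneRing K) S c •
      ((algebraMap _ S ∘ φ.col 0) ⨯₃ (algebraMap _ S ∘ φ.col 1)) := by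
    rw [hc, minors, cross_apply, cross_apply]
    ext j
    fin_cases j <;> simp
  rw [hmap, map_smul, LinearMap.smul_apply, cross_cross_eq_smul_sub_smul, hY₁, zero_smul, zero_sub]
  simpa using (hY₂.mul_right _).mul_left _

/- The point `Y` and `f` are proportional modulo `q`, so the inverse forms `g` satisfy
`x₂ gₖ(Y) = xₖ g₂(Y)` modulo `q`; under `θ` this becomes an equation of degree one. -/
theorem IsHilbertBurch.natDegree_le_one_of_isBirational {L : Type*} [CommRing L] [IsDomain L]
    [Algebra K L] (h : IsHilbertBurch f d μ₁ μ₂ φ) (hbir : IsBirational f)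
    {q : Polynomial (PlaneRing K)} (hq : Prime q) (hq0 : q.natDegree ≠ 0)
    {Y : Fin 3 → Polynomial (PlaneRing K)} (hY₁ : (Polynomial.C ∘ φ.col 0) ⬝ᵥ Y = 0)
    (hY₂ : q ∣ (Polynomial.C ∘ φ.col 1) ⬝ᵥ Y) {y : Fin 3 → L} (hy : AlgebraicIndependent K y)
    (θ : Polynomial (PlaneRing K) →ₐ[K] Polynomial L) (hθY : ∀ i, θ (Y i) = Polynomial.C (y i))
    {u : L} (hu : u ≠ 0) (hθ₂ : θ (Polynomial.C (X 2)) = Polynomial.C u * Polynomial.X)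
    {k : Fin 3} {w : L} (hθk : θ (Polynomial.C (X k)) = Polynomial.C w) :
    θ q ≠ 0 ∧ (θ q).natDegree ≤ 1 := by
  obtain ⟨hdom, e, g, hg, ⟨D, hD, hgf⟩, -⟩ := hbir
  have hf0 : f ≠ 0 := fun h0 => hdom.ne_zero 0 (congrFun h0 0)
  have hqf : ¬ q ∣ Polynomial.C (f 0) := fun hdvd => hq0 <| by
    simpa using Polynomial.natDegree_le_of_dvd hdvd (Polynomial.C_ne_zero.2 (hdom.ne_zero 0))
  have hgf' (j : Fin 3) : aeval (Polynomial.C ∘ f) (g j) = Polynomial.C D * Polynomial.C (X j) := by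
    rw [← map_mul, ← hgf]
    exact (comp_aeval_apply f (Polynomial.CAlgHom (R := K)) (g j)).symm
  have hdvd : q ∣ Polynomial.C (X 2) * aeval Y (g k) - Polynomial.C (X k) * aeval Y (g 2) :=
    dvd_mul_aeval_sub_mul_aeval_of_prime hq (h.dvd_crossProduct_of_dvd_dotProduct hf0 hY₁ hY₂)
      hqf (hg k) (hg 2) (hgf' k) (hgf' 2)
  have hθg (j : Fin 3) : θ (aeval Y (g j)) = Polynomial.C (aeval y (g j)) := by
    rw [comp_aeval_apply, funext hθY]
    exact (comp_aeval_apply y (Polynomial.CAlgHom (R := K)) (g j)).symm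
  have hθdvd : θ q ∣ Polynomial.C (u * aeval y (g k)) * Polynomial.X +
      Polynomial.C (-(w * aeval y (g 2))) := by
    convert map_dvd θ hdvd using 1
    rw [map_sub, map_mul θ, map_mul θ, hθ₂, hθk, hθg, hθg]
    simp only [map_neg, map_mul]
    ring
  have hgk : aeval y (g k) ≠ 0 := fun h0 =>
    mul_ne_zero hD (X_ne_zero k) (by rw [← hgf, hy.eq_zero_of_aeval_eq_zero _ h0, map_zero])
  have hne : Polynomial.C (u * aeval y (g k)) * Polynomial.X +
      Polynomial.C (-(w * aeval y (g 2))) ≠ 0 := by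
    rw [← Polynomial.leadingCoeff_ne_zero, Polynomial.leadingCoeff_linear (mul_ne_zero hu hgk)]
    exact mul_ne_zero hu hgk
  exact ⟨ne_zero_of_dvd_ne_zero hne hθdvd,
    (Polynomial.natDegree_le_of_dvd hθdvd hne).trans Polynomial.natDegree_linear_le⟩

end DegreeBound

section NormalForm

variable {K : Type*} [Field K] {d μ₂ : ℕ} {f : Fin 3 → PlaneRing K}
  {φ : Matrix (Fin 3) (Fin 2) (PlaneRing K)}

/-- The graph of the rational map satisfies `(y₀, y₁, y₂) φ = 0`. When `φ` has first column
`(x₀, -x₁, 0)`, the points of source coordinates `(y₁ : y₀ : s)` are those satisfying the first of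
these equations; this is the restriction of the second one to them, as a polynomial in `s`. -/
noncomputable def fiberPolynomial (φ : Matrix (Fin 3) (Fin 2) (PlaneRing K)) :
    Polynomial (MvPolynomial (Fin 3) K) :=
  ∑ i, Polynomial.C (X i) *
    aeval ![Polynomial.C (X 1), Polynomial.C (X 0), Polynomial.X] (φ i 1)

theorem IsNormalForm.minors_eq (hφ : IsNormalForm φ) :
    minors φ = ![-(X 1 * φ 2 1), -(X 0 * φ 2 1), X 0 * φ 1 1 + X 1 * φ 0 1] := by
  rw [minors, cross_apply]
  simp [col_apply, hφ.1, hφ.2.1, hφ.2.2]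

theorem IsHilbertBurch.isRelPrime_of_isNormalForm (h : IsHilbertBurch f d 1 μ₂ φ) (hf0 : f ≠ 0)
    (hφ : IsNormalForm φ) : IsRelPrime (φ 2 1) (X 0 * φ 1 1 + X 1 * φ 0 1) := by
  intro e he₁ he₂
  refine h.hasNoCommonFactor_minors hf0 e fun i => ?_
  rw [hφ.minors_eq]
  fin_cases i
  · exact (he₁.mul_left _).neg_right
  · exact (he₁.mul_left _).neg_right
  · exact he₂

theorem IsHilbertBurch.apply_two_one_ne_zero (h : IsHilbertBurch f d 1 μ₂ φ)
    (hdom : IsDominant f) (hφ : IsNormalForm φ) : φ 2 1 ≠ 0 := by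
  have hf0 : f ≠ 0 := fun h0 => hdom.ne_zero 0 (congrFun h0 0)
  obtain ⟨c, hc, -⟩ := exists_eq_smul_minors hf0 h.exact
  intro hp
  apply hdom.ne_zero 0
  rw [hc, hφ.minors_eq, hp]
  simp

theorem IsHilbertBurch.natDegree_fiberPolynomial_le_one (h : IsHilbertBurch f d 1 μ₂ φ)
    (hbir : IsBirational f) (hφ : IsNormalForm φ) :
    fiberPolynomial φ ≠ 0 ∧ (fiberPolynomial φ).natDegree ≤ 1 := by
  set q := Polynomial.C (φ 2 1) * Polynomial.X + Polynomial.C (X 0 * φ 1 1 + X 1 * φ 0 1)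
  have hf0 : f ≠ 0 := fun h0 => hbir.1.ne_zero 0 (congrFun h0 0)
  have hp : φ 2 1 ≠ 0 := h.apply_two_one_ne_zero hbir.1 hφ
  let Y : Fin 3 → Polynomial (PlaneRing K) :=
    ![Polynomial.C (X 1), Polynomial.C (X 0), Polynomial.X]
  have hY₁ : (Polynomial.C ∘ φ.col 0) ⬝ᵥ Y = 0 := by
    rw [vec3_dotProduct]
    simp only [Y, Function.comp_apply, col_apply, hφ.1, hφ.2.1, hφ.2.2, cons_val, map_neg, map_zero]
    ring
  have hY₂ : (Polynomial.C ∘ φ.col 1) ⬝ᵥ Y = q := by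
    rw [vec3_dotProduct]
    simp only [Y, q, Function.comp_apply, col_apply, cons_val, map_add, map_mul]
    ring
  have hprime : Prime q := UniqueFactorizationMonoid.irreducible_iff_prime.1 <|
    Polynomial.irreducible_C_mul_X_add_C hp (h.isRelPrime_of_isNormalForm hf0 hφ)
  have hq0 : q.natDegree ≠ 0 := by rw [Polynomial.natDegree_linear hp]; exact one_ne_zero
  let θ : Polynomial (PlaneRing K) →ₐ[K] Polynomial (MvPolynomial (Fin 3) K) :=
    Polynomial.aevalTower (aeval ![Polynomial.C (X 1), Polynomial.C (X 0), Polynomial.X])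
      (Polynomial.C (X 2))
  have hθY (i : Fin 3) : θ (Y i) = Polynomial.C (X i) := by fin_cases i <;> simp [Y, θ]
  have hθq : θ q = fiberPolynomial φ := by
    rw [← hY₂, dotProduct, map_sum, fiberPolynomial]
    refine Finset.sum_congr rfl fun i _ => ?_
    rw [map_mul, hθY, mul_comm]
    simp [θ]
  rw [← hθq]
  exact h.natDegree_le_one_of_isBirational hbir hprime hq0 hY₁ hY₂.symm.dvd
    (algebraicIndependent_X (Fin 3) K) θ hθY (k := 0) one_ne_zero (by simp [θ]) (w := X 1)
    (by simp [θ])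

theorem IsHilbertBurch.exists_eq_mul_of_isNormalForm (h : IsHilbertBurch f d 1 μ₂ φ)
    (hf0 : f ≠ 0) (hφ : IsNormalForm φ) : ∃ η, f 0 = η * X 1 ∧ f 1 = η * X 0 := by
  obtain ⟨c, hc, -⟩ := exists_eq_smul_minors hf0 h.exact
  refine ⟨-(c * φ 2 1), ?_, ?_⟩ <;> rw [hc, hφ.minors_eq, Pi.smul_apply, smul_eq_mul]
  · simp only [cons_val_zero]
    ring
  · simp only [cons_val_one, cons_val_zero]
    ring

/- Over the point `f(x)` of the target, the value `s = η x₂` of the parameter gives the point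
`η x` of the source. -/
theorem IsHilbertBurch.aevalTower_fiberPolynomial (h : IsHilbertBurch f d 1 μ₂ φ)
    {η : PlaneRing K} (hη₀ : f 0 = η * X 1) (hη₁ : f 1 = η * X 0) :
    Polynomial.aevalTower (aeval (R := K) f) (η * X 2) (fiberPolynomial φ) = 0 := by
  have hpoint (i : Fin 3) : Polynomial.aevalTower (aeval (R := K) f) (η * X 2)
      ((![Polynomial.C (X 1), Polynomial.C (X 0), Polynomial.X] : Fin 3 → _) i) =
      (η • X : Fin 3 → PlaneRing K) i := by
    fin_cases i <;> simp [hη₀, hη₁]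
  have hcol : ∑ i, f i * φ i 1 = 0 := h.dotProduct_col 1
  simp only [fiberPolynomial, map_sum, map_mul, Polynomial.aevalTower_C, aeval_X, comp_aeval_apply,
    hpoint]
  simp only [fun i => aeval_smul_of_isHomogeneous (h.homogeneous₂ i) η X, aeval_X_left_apply,
    mul_left_comm (f _)]
  rw [← Finset.mul_sum, hcol, mul_zero]

theorem IsHilbertBurch.natDegree_fiberPolynomial_eq_one (h : IsHilbertBurch f d 1 μ₂ φ)
    (hbir : IsBirational f) (hφ : IsNormalForm φ) : (fiberPolynomial φ).natDegree = 1 := by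
  have hf0 : f ≠ 0 := fun h0 => hbir.1.ne_zero 0 (congrFun h0 0)
  obtain ⟨hne, hle⟩ := h.natDegree_fiberPolynomial_le_one hbir hφ
  refine hle.antisymm (Nat.one_le_iff_ne_zero.2 fun hdeg => ?_)
  obtain ⟨r, hr⟩ := Polynomial.natDegree_eq_zero.1 hdeg
  obtain ⟨η, hη₀, hη₁⟩ := h.exists_eq_mul_of_isNormalForm hf0 hφ
  have hroot := h.aevalTower_fiberPolynomial hη₀ hη₁
  rw [← hr, Polynomial.aevalTower_C] at hroot
  rw [← hr, hbir.1.eq_zero_of_aeval_eq_zero _ hroot, Polynomial.C_0] at hne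
  exact hne rfl

theorem coeff_aeval_fiberPoint (p : PlaneRing K) (k : ℕ) :
    (aeval ![Polynomial.C (X 1 : MvPolynomial (Fin 3) K), Polynomial.C (X 0), Polynomial.X]
      p).coeff k =
      ∑ m ∈ p.support, if k = m 2 then C (coeff m p) * (X 1 ^ m 0 * X 0 ^ m 1) else 0 := by
  rw [aeval_def, eval₂_eq', Polynomial.finsetSum_coeff]
  refine Finset.sum_congr rfl fun m _ => ?_
  rw [Fin.prod_univ_three, IsScalarTower.algebraMap_apply K (MvPolynomial (Fin 3) K)
    (Polynomial _), Polynomial.algebraMap_eq, algebraMap_eq, ← mul_assoc]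
  simp only [cons_val, ← map_pow, ← map_mul]
  exact Polynomial.coeff_C_mul_X_pow ..

theorem isHomogeneous_coeff_aeval_fiberPoint {p : PlaneRing K} {n : ℕ} (hp : p.IsHomogeneous n)
    (k : ℕ) : ((aeval ![Polynomial.C (X 1 : MvPolynomial (Fin 3) K), Polynomial.C (X 0),
      Polynomial.X] p).coeff k).IsHomogeneous (n - k) := by
  rw [coeff_aeval_fiberPoint]
  refine IsHomogeneous.sum _ _ _ fun m hm => ?_
  have hdeg := hp.degree_eq_sum_deg_support hm
  rw [← Finsupp.degree_apply, Finsupp.degree_eq_sum, Fin.sum_univ_three] at hdeg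
  split_ifs with hk
  · rw [show n - k = m 0 + m 1 by lia]
    exact ((isHomogeneous_X_pow _ _).mul (isHomogeneous_X_pow _ _)).C_mul _
  · exact isHomogeneous_zero _ _ _

theorem isHomogeneous_coeff_fiberPolynomial (hφ : ∀ i, (φ i 1).IsHomogeneous μ₂) (k : ℕ) :
    ((fiberPolynomial φ).coeff k).IsHomogeneous (1 + (μ₂ - k)) := by
  rw [fiberPolynomial, Polynomial.finsetSum_coeff]
  refine IsHomogeneous.sum _ _ _ fun i _ => ?_
  rw [Polynomial.coeff_C_mul]
  exact (isHomogeneous_X _ _).mul (isHomogeneous_coeff_aeval_fiberPoint (hφ i) k)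

theorem IsHilbertBurch.isBirational_of_natDegree_fiberPolynomial (h : IsHilbertBurch f d 1 μ₂ φ)
    (hf : ∀ i, (f i).IsHomogeneous d) (hdom : IsDominant f) (hφ : IsNormalForm φ)
    (hdeg : (fiberPolynomial φ).natDegree = 1) : IsBirational f := by
  set α := (fiberPolynomial φ).coeff 1 with hα
  set β := (fiberPolynomial φ).coeff 0
  have hf0 : f ≠ 0 := fun h0 => hdom.ne_zero 0 (congrFun h0 0)
  obtain ⟨η, hη₀, hη₁⟩ := h.exists_eq_mul_of_isNormalForm hf0 hφ
  have hη : η ≠ 0 := by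
    rintro rfl
    exact hdom.ne_zero 0 (by rw [hη₀, zero_mul])
  have hα0 : α ≠ 0 := by
    rw [hα, ← hdeg, Polynomial.coeff_natDegree, Polynomial.leadingCoeff_ne_zero]
    exact Polynomial.ne_zero_of_natDegree_gt (n := 0) (by lia)
  have hroot : aeval f α * (η * X 2) + aeval f β = 0 := by
    have hroot := h.aevalTower_fiberPolynomial hη₀ hη₁
    rw [Polynomial.eq_X_add_C_of_natDegree_le_one hdeg.le] at hroot
    simpa only [map_add, map_mul, Polynomial.aevalTower_C, Polynomial.aevalTower_X] using hroot
  have hαhom : α.IsHomogeneous μ₂ := by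
    have h1 : 1 ≤ μ₂ := h.le
    simpa [add_tsub_cancel_of_le h1] using isHomogeneous_coeff_fiberPolynomial h.homogeneous₂ 1
  have hβhom : β.IsHomogeneous (1 + μ₂) := isHomogeneous_coeff_fiberPolynomial h.homogeneous₂ 0
  have hαf : aeval f α ≠ 0 := fun h0 => hα0 (hdom.eq_zero_of_aeval_eq_zero _ h0)
  refine hdom.isBirational hf (g := ![X 1 * α, X 0 * α, -β]) (e := 1 + μ₂) (fun j => ?_)
    (mul_ne_zero hη hαf) fun j => ?_
  · fin_cases j
    exacts [(isHomogeneous_X _ _).mul hαhom, (isHomogeneous_X _ _).mul hαhom, hβhom.neg]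
  · fin_cases j <;> simp only [Fin.reduceFinMk, Fin.zero_eta, Fin.mk_one, cons_val, map_mul,
      map_neg, aeval_X, hη₀, hη₁]
    · ring
    · ring
    · linear_combination -hroot

end NormalForm

section LeadingCoefficient

universe u

theorem coeff_aeval_of_natDegree_le_one {K σ : Type*} {A : Type u} [CommSemiring K] [CommSemiring A]
    [Algebra K A] {p : MvPolynomial σ K} {n : ℕ} (hp : p.IsHomogeneous n)
    {u : σ → Polynomial A} (hu : ∀ i, (u i).natDegree ≤ 1) :
    (aeval u p).coeff n = aeval (fun i => (u i).coeff 1) p := by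
  rw [aeval_def, aeval_def, eval₂_eq, eval₂_eq, Polynomial.finsetSum_coeff]
  refine Finset.sum_congr rfl fun m hm => ?_
  rw [IsScalarTower.algebraMap_apply K A (Polynomial A), Polynomial.algebraMap_eq,
    Polynomial.coeff_C_mul]
  have hn : (m.toMultiset.map u).card * 1 = n := by
    rw [hp.degree_eq_sum_deg_support hm, Multiset.card_map, Finsupp.card_toMultiset, mul_one]
    rfl
  have hprod {B : Type u} [CommSemiring B] (w : σ → B) :
      ∏ i ∈ m.support, w i ^ m i = (m.toMultiset.map w).prod := by
    rw [Finsupp.toMultiset_map, Finsupp.prod_toMultiset, Finsupp.prod_mapDomain_index] <;>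
      simp [Finsupp.prod, pow_add]
  rw [hprod, hprod, ← hn, Polynomial.coeff_multiset_prod_of_natDegree_le _ _ (by simp [hu]),
    Multiset.map_map]
  rfl

end LeadingCoefficient

section CoordinateColumn

variable {K : Type*} [Field K] {d μ₂ : ℕ} {f : Fin 3 → PlaneRing K}
  {φ : Matrix (Fin 3) (Fin 2) (PlaneRing K)}

theorem minors_eq_of_col_eq_X (hcol : φ.col 0 = X) : minors φ =
    ![X 1 * φ 2 1 - X 2 * φ 1 1, X 2 * φ 0 1 - X 0 * φ 2 1, X 0 * φ 1 1 - X 1 * φ 0 1] := by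
  rw [minors, hcol, cross_apply]
  rfl

/- On the line `x₁ = 0` the form `Σ yᵢ pᵢ` can only vanish identically if `x₁` divides every
minor. -/
theorem IsHilbertBurch.sum_X_mul_aeval_ne_zero (h : IsHilbertBurch f d 1 μ₂ φ) (hf0 : f ≠ 0)
    (hcol : φ.col 0 = X) :
    ∑ i, X i * aeval ![-X 2, 0, (X 0 : MvPolynomial (Fin 3) K)] (φ i 1) ≠ 0 := by
  intro hzero
  let v : Fin 3 → PlaneRing K := ![X 0, 0, X 2]
  have heval (w : PlaneRing K) :
      X 2 * aeval v (φ 0 1) + w * aeval v (φ 1 1) - X 0 * aeval v (φ 2 1) = 0 := by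
    have hv : (fun i => aeval ![X 2, w, -X 0] (![-X 2, 0, (X 0 : MvPolynomial (Fin 3) K)] i)) =
        v := by
      ext1 i
      fin_cases i <;> simp [v]
    have himage := congrArg (aeval ![X 2, w, -X 0]) hzero
    simp only [Fin.sum_univ_three, map_add, map_mul, map_zero, comp_aeval_apply, hv, aeval_X,
      cons_val] at himage
    linear_combination himage
  have hX (p : PlaneRing K) : X 1 ∣ p - aeval v p := by
    have hXv (i : Fin 3) : (X 1 : PlaneRing K) ∣ X i - v i := by fin_cases i <;> simp [v]
    simpa only [aeval_X_left_apply] using dvd_aeval_sub_aeval hXv p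
  have hp₁ : X 1 ∣ φ 1 1 := by
    have : aeval v (φ 1 1) = 0 := by linear_combination heval 1 - heval 0
    simpa only [this, sub_zero] using hX (φ 1 1)
  have hp₀₂ : X 1 ∣ X 2 * φ 0 1 - X 0 * φ 2 1 := by
    convert dvd_sub ((hX (φ 0 1)).mul_left (X 2)) ((hX (φ 2 1)).mul_left (X 0)) using 1
    linear_combination heval 0
  refine X_prime.not_isUnit (h.hasNoCommonFactor_minors hf0 (X 1) fun i => ?_)
  rw [minors_eq_of_col_eq_X hcol]
  fin_cases i
  · exact dvd_sub (dvd_mul_right ..) (hp₁.mul_left _)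
  · exact hp₀₂
  · exact dvd_sub (hp₁.mul_left _) (dvd_mul_right ..)

theorem IsHilbertBurch.exists_minors_eq_mul (h : IsHilbertBurch f d 1 μ₂ φ) (hf0 : f 0 ≠ 0)
    (hcol : φ.col 0 = X) : ∃ a b c, minors φ 0 = c * a ∧ minors φ 2 = c * b ∧ a ≠ 0 ∧
      IsRelPrime a b ∧ c ∣ X 1 := by
  have hf : f ≠ 0 := fun h0 => hf0 (congrFun h0 0)
  obtain ⟨e, he, hnc⟩ := exists_eq_smul_minors hf h.exact
  have hm : minors φ 0 ≠ 0 := by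
    rw [he] at hf0
    exact right_ne_zero_of_mul hf0
  obtain ⟨a, b, c, hab, ha, hb⟩ :=
    UniqueFactorizationMonoid.exists_reduced_factors (minors φ 0) hm (minors φ 2)
  refine ⟨a, b, c, ha.symm, hb.symm, right_ne_zero_of_mul (ha ▸ hm), hab, ?_⟩
  have hX : X 0 * minors φ 0 + X 1 * minors φ 1 + X 2 * minors φ 2 = 0 := by
    rw [minors_eq_of_col_eq_X hcol]
    simp only [cons_val]
    ring
  exact hnc.dvd_of_forall_dvd_mul fun
    | 0 => (Dvd.intro _ ha).mul_left _
    | 1 => ⟨-(X 0 * a + X 2 * b), by linear_combination hX + X 0 * ha + X 2 * hb⟩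
    | 2 => (Dvd.intro _ hb).mul_left _

/-- A point of the target, with parameter `z`, which satisfies the equation
`x₀ y₀ + x₁ y₁ + x₂ y₂ = 0` together with the point `(x₀ : x₁ : x₂)` of the source. -/
noncomputable def incidentPoint (K : Type*) [Field K] : Fin 3 → Polynomial (PlaneRing K) :=
  ![Polynomial.C (X 1), -(Polynomial.C (X 0) + Polynomial.C (X 2) * Polynomial.X),
    Polynomial.C (X 1) * Polynomial.X]

/-- A point of the source, with parameter `s`, on the line `x₀ y₀ + x₁ y₁ + x₂ y₂ = 0`. -/
noncomputable def incidentLine {L : Type*} [CommRing L] (y : Fin 3 → L) : Fin 3 → Polynomial L :=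
  ![-(Polynomial.C (y 1) + Polynomial.C (y 2) * Polynomial.X), Polynomial.C (y 0),
    Polynomial.C (y 0) * Polynomial.X]

theorem IsHilbertBurch.exists_prime_eq_dotProduct_incidentPoint (h : IsHilbertBurch f d 1 μ₂ φ)
    (hf0 : f 0 ≠ 0) (hcol : φ.col 0 = X) : ∃ c q, c ∣ X 1 ∧ Prime q ∧ q.natDegree ≠ 0 ∧
      (Polynomial.C ∘ φ.col 1) ⬝ᵥ incidentPoint K = Polynomial.C c * q := by
  obtain ⟨a, b, c, ha, hb, ha0, hab, hc⟩ := h.exists_minors_eq_mul hf0 hcol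
  refine ⟨c, Polynomial.C a * Polynomial.X + Polynomial.C (-b), hc,
    UniqueFactorizationMonoid.irreducible_iff_prime.1 <|
      Polynomial.irreducible_C_mul_X_add_C ha0 hab.neg_right,
    by rw [Polynomial.natDegree_linear ha0]; exact one_ne_zero, ?_⟩
  rw [minors_eq_of_col_eq_X hcol] at ha hb
  have ha' := congrArg Polynomial.C ha
  have hb' := congrArg Polynomial.C hb
  simp only [cons_val, map_sub, map_mul] at ha' hb'
  rw [vec3_dotProduct]
  simp only [incidentPoint, Function.comp_apply, col_apply, cons_val, map_neg]
  linear_combination Polynomial.X * ha' - hb'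

theorem IsHilbertBurch.natDegree_sum_incidentLine_le_one {L : Type*} [Field L] [Algebra K L]
    (h : IsHilbertBurch f d 1 μ₂ φ) (hbir : IsBirational f) (hcol : φ.col 0 = X)
    {y : Fin 3 → L} (hy : AlgebraicIndependent K y) :
    (∑ i, Polynomial.C (y i) * aeval (incidentLine y) (φ i 1)).natDegree ≤ 1 := by
  obtain ⟨c, q, hc, hq, hq0, hcol₂⟩ :=
    h.exists_prime_eq_dotProduct_incidentPoint (hbir.1.ne_zero 0) hcol
  have hcol₁ : (Polynomial.C ∘ φ.col 0) ⬝ᵥ incidentPoint K = 0 := by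
    rw [vec3_dotProduct, hcol]
    simp only [incidentPoint, Function.comp_apply, cons_val]
    ring
  let θ : Polynomial (PlaneRing K) →ₐ[K] Polynomial L :=
    Polynomial.aevalTower (aeval (incidentLine y)) (Polynomial.C (y 2 / y 0))
  have hθC (p : PlaneRing K) : θ (Polynomial.C p) = aeval (incidentLine y) p :=
    Polynomial.aevalTower_C ..
  have hθX : θ Polynomial.X = Polynomial.C (y 2 / y 0) := Polynomial.aevalTower_X ..
  have hy0 : y 0 ≠ 0 := hy.ne_zero 0
  have hdiv : Polynomial.C (y 0) * Polynomial.C (y 2 / y 0) = Polynomial.C (y 2) := by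
    rw [← map_mul, mul_div_cancel₀ _ hy0]
  have hθY (i : Fin 3) : θ (incidentPoint K i) = Polynomial.C (y i) := by
    fin_cases i <;> simp only [Fin.reduceFinMk, Fin.zero_eta, Fin.mk_one, incidentPoint, cons_val,
      map_neg, map_add, map_mul, hθC, hθX, aeval_X, incidentLine]
    · linear_combination -Polynomial.X * hdiv
    · exact hdiv
  have hθcol₂ : θ (Polynomial.C c * q) =
      ∑ i, Polynomial.C (y i) * aeval (incidentLine y) (φ i 1) := by
    rw [← hcol₂, dotProduct, map_sum]
    refine Finset.sum_congr rfl fun i _ => ?_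
    rw [map_mul, hθY, mul_comm, Function.comp_apply, hθC, col_apply]
  obtain ⟨-, hle⟩ := h.natDegree_le_one_of_isBirational hbir hq hq0 hcol₁
    (hcol₂ ▸ dvd_mul_left _ _) hy θ hθY (k := 1) hy0
    (by rw [hθC, aeval_X]; rfl) (w := y 0) (by rw [hθC, aeval_X]; rfl)
  have hθc : IsUnit (θ (Polynomial.C c)) := by
    refine isUnit_of_dvd_unit (map_dvd θ (map_dvd Polynomial.C hc)) ?_
    rw [hθC, aeval_X]
    exact Polynomial.isUnit_C.2 hy0.isUnit
  rw [← hθcol₂, map_mul]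
  exact Polynomial.natDegree_mul_le_of_le (Polynomial.natDegree_eq_zero_of_isUnit hθc).le hle

theorem IsHilbertBurch.not_isBirational_of_col_eq_X (h : IsHilbertBurch f d 1 μ₂ φ)
    (hμ : 2 ≤ μ₂) (hcol : φ.col 0 = X) : ¬ IsBirational f := by
  intro hbir
  have hf0 : f ≠ 0 := fun h0 => hbir.1.ne_zero 0 (congrFun h0 0)
  obtain ⟨L, _, _, y, hy⟩ : ∃ (L : Type _) (_ : Field L) (_ : Algebra K L) (y : Fin 3 → L),
      AlgebraicIndependent K y :=
    ⟨FractionRing (MvPolynomial (Fin 3) K), inferInstance, inferInstance, _,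
      (algebraicIndependent_X (Fin 3) K).map'
        (f := IsScalarTower.toAlgHom K _ (FractionRing (MvPolynomial (Fin 3) K)))
        (IsFractionRing.injective _ _)⟩
  have hdeg (i : Fin 3) : (incidentLine y i).natDegree ≤ 1 := by
    fin_cases i <;>
      simp only [Fin.reduceFinMk, Fin.zero_eta, Fin.mk_one, incidentLine, cons_val] <;>
      compute_degree!
  have hlead : (fun i => (incidentLine y i).coeff 1) =
      fun i => aeval (R := K) y (![-X 2, 0, X 0] i) := by
    ext1 i
    fin_cases i <;> simp [incidentLine, Polynomial.coeff_C]
  have hcoeff := Polynomial.coeff_eq_zero_of_natDegree_lt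
    ((h.natDegree_sum_incidentLine_le_one hbir hcol hy).trans_lt hμ)
  refine h.sum_X_mul_aeval_ne_zero hf0 hcol (hy.eq_zero_of_aeval_eq_zero _ ?_)
  simpa only [Polynomial.finsetSum_coeff, Polynomial.coeff_C_mul, hlead, map_sum, map_mul,
    coeff_aeval_of_natDegree_le_one (h.homogeneous₂ _) hdeg, aeval_X, comp_aeval_apply] using hcoeff

end CoordinateColumn

section Sylvester

variable {K : Type*} [Field K] {μ₂ m : ℕ} {φ : Matrix (Fin 3) (Fin 2) (PlaneRing K)}
  {F : ℕ → BiRing K}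

/-- The substitution `x₀ ↦ t y₁`, `x₁ ↦ t y₀`, `x₂ ↦ x₂`, with values in `𝒜[t]`: the graph
equation `x₀ y₀ = x₁ y₁` of a normal form makes `(x₀, x₁)` proportional to `(y₁, y₀)`. Passing from
one Sylvester form to the next divides its image by `t`. -/
noncomputable def blowup (K : Type*) [Field K] : BiRing K →ₐ[K] Polynomial (BiRing K) :=
  aevalTower
    (aeval ![Polynomial.X * Polynomial.C (X 1), Polynomial.X * Polynomial.C (X 0),
      Polynomial.C (C (X 2))])
    fun i => Polynomial.C (X i)

theorem blowup_C (p : PlaneRing K) : blowup K (C p) =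
    aeval ![Polynomial.X * Polynomial.C (X 1), Polynomial.X * Polynomial.C (X 0),
      Polynomial.C (C (X 2))] p :=
  aevalTower_C ..

theorem blowup_X (i : Fin 3) : blowup K (X i) = Polynomial.C (X i) :=
  aevalTower_X ..

theorem mem_axisIdeal_iff (G : BiRing K) : G ∈ axisIdeal K ↔ Polynomial.X ∣ blowup K G := by
  let ε : Polynomial (BiRing K) →ₐ[K] BiRing K ⧸ axisIdeal K :=
    (Ideal.Quotient.mkₐ K (axisIdeal K)).comp (Polynomial.aevalTower (AlgHom.id K _) 0)
  have hmk₀ : Ideal.Quotient.mk (axisIdeal K) (C (X 0)) = 0 :=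
    Ideal.Quotient.eq_zero_iff_mem.2 (Ideal.subset_span (Or.inl rfl))
  have hmk₁ : Ideal.Quotient.mk (axisIdeal K) (C (X 1)) = 0 :=
    Ideal.Quotient.eq_zero_iff_mem.2 (Ideal.subset_span (Or.inr rfl))
  have hε : ε.comp (blowup K) = Ideal.Quotient.mkₐ K (axisIdeal K) := by
    refine algHom_ext' (B := BiRing K ⧸ axisIdeal K) ?_ fun i => ?_
    · refine algHom_ext fun i => ?_
      fin_cases i <;> simp [ε, algebraMap_eq, blowup_C, hmk₀, hmk₁]
    · simp [ε, blowup_X]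
  constructor
  · intro hG
    obtain ⟨a, b, rfl⟩ := Ideal.mem_span_pair.1 hG
    simp only [map_add, map_mul, blowup_C, aeval_X, cons_val]
    exact dvd_add ((dvd_mul_right ..).mul_left _) ((dvd_mul_right ..).mul_left _)
  · intro hG
    have h0 : ε (blowup K G) = 0 := by simpa [ε] using map_dvd ε hG
    rw [← Ideal.Quotient.eq_zero_iff_mem]
    exact (DFunLike.congr_fun hε G).symm.trans h0

theorem blowup_eq_X_mul {G a b : BiRing K} (hG : G = a * C (X 0) + b * C (X 1)) :
    blowup K G = Polynomial.X * blowup K (det !![X 0, -X 1; a, b]) := by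
  rw [hG, det_fin_two_of]
  simp only [map_add, map_sub, map_mul, map_neg, blowup_C, blowup_X, aeval_X, cons_val]
  ring

theorem IsSylvesterRun.blowup_secondEquation_eq (h : IsSylvesterRun φ F m) {i : ℕ} (hi : i ≤ m) :
    blowup K (secondEquation φ) = Polynomial.X ^ i * blowup K (F i) := by
  induction i with
  | zero => rw [h.1, pow_zero, one_mul]
  | succ i ih =>
    obtain ⟨a, b, hab, hnext⟩ := h.2.1 i hi
    rw [ih (by lia), hnext, blowup_eq_X_mul hab, pow_succ, mul_assoc]

theorem IsSylvesterRun.emultiplicity_eq (h : IsSylvesterRun φ F m) :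
    emultiplicity Polynomial.X (blowup K (secondEquation φ)) = m := by
  rw [emultiplicity_eq_coe, h.blowup_secondEquation_eq le_rfl, pow_succ,
    mul_dvd_mul_iff_left (pow_ne_zero m Polynomial.X_ne_zero), ← mem_axisIdeal_iff]
  exact ⟨dvd_mul_right .., h.2.2⟩

theorem exists_sylvesterForms {G : BiRing K}
    (hG : emultiplicity Polynomial.X (blowup K G) = m) : ∃ F : ℕ → BiRing K, F 0 = G ∧
      (∀ i < m, ∃ a b : BiRing K,
        F i = a * C (X 0) + b * C (X 1) ∧ F (i + 1) = det !![X 0, -X 1; a, b]) ∧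
      F m ∉ axisIdeal K := by
  induction m generalizing G with
  | zero =>
    rw [Nat.cast_zero, emultiplicity_eq_zero, ← mem_axisIdeal_iff] at hG
    exact ⟨fun _ => G, rfl, by simp, hG⟩
  | succ m ih =>
    obtain ⟨a, b, hab⟩ : ∃ a b, a * C (X 0) + b * C (X 1) = G := by
      rw [← Ideal.mem_span_pair]
      exact (mem_axisIdeal_iff G).2 (dvd_of_emultiplicity_pos (hG ▸ by simp))
    have hnext : emultiplicity Polynomial.X (blowup K (det !![X 0, -X 1; a, b])) = m := by
      rw [emultiplicity_eq_coe] at hG ⊢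
      simpa only [blowup_eq_X_mul hab.symm, pow_succ' _ m, pow_succ' _ (m + 1),
        mul_dvd_mul_iff_left (Polynomial.X_ne_zero (R := BiRing K))] using hG
    obtain ⟨F, hF₀, hstep, hlast⟩ := ih hnext
    refine ⟨fun | 0 => G | i + 1 => F i, rfl, fun i hi => ?_, hlast⟩
    cases i with
    | zero => exact ⟨a, b, hab.symm, hF₀⟩
    | succ i => exact hstep i (by lia)

theorem sylvesterSteps_iff_emultiplicity_eq : SylvesterSteps φ m ↔
    emultiplicity Polynomial.X (blowup K (secondEquation φ)) = m := by
  constructor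
  · rintro ⟨⟨F, hF⟩, -⟩
    exact hF.emultiplicity_eq
  · intro hm
    refine ⟨exists_sylvesterForms hm, fun F n hF => ?_⟩
    exact_mod_cast hF.emultiplicity_eq.symm.trans hm

theorem coeff_blowup_C {p : PlaneRing K} {n : ℕ} (hp : p.IsHomogeneous n) {k : ℕ} (hk : k ≤ n) :
    (blowup K (C p)).coeff k =
      map C ((aeval ![Polynomial.C (X 1 : MvPolynomial (Fin 3) K), Polynomial.C (X 0),
        Polynomial.X] p).coeff (n - k)) * C (X 2) ^ (n - k) := by
  rw [blowup_C, coeff_aeval_fiberPoint, aeval_def, eval₂_eq', Polynomial.finsetSum_coeff, map_sum,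
    Finset.sum_mul]
  refine Finset.sum_congr rfl fun m hm => ?_
  have hdeg := hp.degree_eq_sum_deg_support hm
  rw [← Finsupp.degree_apply, Finsupp.degree_eq_sum, Fin.sum_univ_three] at hdeg
  have hterm : algebraMap K (Polynomial (BiRing K)) (coeff m p) *
      ∏ i, (![Polynomial.X * Polynomial.C (X 1), Polynomial.X * Polynomial.C (X 0),
        Polynomial.C (C (X 2))] : Fin 3 → Polynomial (BiRing K)) i ^ m i =
      Polynomial.C (map C (C (coeff m p) * (X 1 ^ m 0 * X 0 ^ m 1)) * C (X 2) ^ m 2) *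
        Polynomial.X ^ (m 0 + m 1) := by
    rw [Fin.prod_univ_three, IsScalarTower.algebraMap_apply K (BiRing K) (Polynomial _),
      Polynomial.algebraMap_eq]
    simp only [cons_val, map_mul, map_pow, map_C, map_X]
    rw [show algebraMap K (BiRing K) (coeff m p) = C (C (coeff m p)) from rfl]
    ring
  rw [hterm, Polynomial.coeff_C_mul_X_pow]
  by_cases hkm : k = m 0 + m 1
  · rw [if_pos hkm, if_pos (by lia), show n - k = m 2 by lia]
  · rw [if_neg hkm, if_neg (by lia), map_zero, zero_mul]

theorem coeff_blowup_secondEquation (hφ : ∀ i, (φ i 1).IsHomogeneous μ₂) {k : ℕ} (hk : k ≤ μ₂) :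
    (blowup K (secondEquation φ)).coeff k =
      map C ((fiberPolynomial φ).coeff (μ₂ - k)) * C (X 2) ^ (μ₂ - k) := by
  simp only [secondEquation, fiberPolynomial, map_sum, map_mul, blowup_X, map_X,
    Polynomial.finsetSum_coeff, Polynomial.coeff_C_mul, coeff_blowup_C (hφ _) hk, Finset.sum_mul,
    mul_assoc]

theorem natDegree_fiberPolynomial_le (hφ : ∀ i, (φ i 1).IsHomogeneous μ₂) :
    (fiberPolynomial φ).natDegree ≤ μ₂ := by
  refine Polynomial.natDegree_le_iff_coeff_eq_zero.2 fun k hk => ?_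
  simp only [fiberPolynomial, Polynomial.finsetSum_coeff, Polynomial.coeff_C_mul,
    coeff_aeval_fiberPoint]
  refine Finset.sum_eq_zero fun i _ => mul_eq_zero_of_right _ <| Finset.sum_eq_zero fun m hm => ?_
  have hdeg := (hφ i).degree_eq_sum_deg_support hm
  rw [← Finsupp.degree_apply] at hdeg
  have hm₂ : m 2 ≤ μ₂ := hdeg ▸ Finsupp.le_degree 2 m
  exact if_neg (by lia)

theorem sylvesterSteps_iff_natDegree_fiberPolynomial (hφ : ∀ i, (φ i 1).IsHomogeneous μ₂)
    (hm : m < μ₂) : SylvesterSteps φ m ↔ (fiberPolynomial φ).natDegree = μ₂ - m := by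
  have hcoeff {k : ℕ} (hk : k ≤ μ₂) : (blowup K (secondEquation φ)).coeff k = 0 ↔
      (fiberPolynomial φ).coeff (μ₂ - k) = 0 := by
    rw [coeff_blowup_secondEquation hφ hk, mul_eq_zero_iff_right (pow_ne_zero _ (by simp)),
      map_eq_zero_iff _ (map_injective _ (C_injective _ _))]
  rw [sylvesterSteps_iff_emultiplicity_eq, emultiplicity_eq_coe]
  constructor
  · rintro ⟨hdvd, hndvd⟩
    have hlow : ∀ k < m, (fiberPolynomial φ).coeff (μ₂ - k) = 0 := fun k hk =>
      (hcoeff (by lia)).1 (Polynomial.X_pow_dvd_iff.1 hdvd k hk)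
    refine Polynomial.natDegree_eq_of_le_of_coeff_ne_zero
      (Polynomial.natDegree_le_iff_coeff_eq_zero.2 fun k hk => ?_) fun hzero => ?_
    · rcases le_or_gt k μ₂ with hk' | hk'
      · rw [← Nat.sub_sub_self hk']
        exact hlow _ (by lia)
      · exact Polynomial.coeff_eq_zero_of_natDegree_lt
          ((natDegree_fiberPolynomial_le hφ).trans_lt hk')
    · refine hndvd (Polynomial.X_pow_dvd_iff.2 fun k hk => (hcoeff (by lia)).2 ?_)
      rcases (Nat.lt_succ_iff.1 hk).lt_or_eq with hk' | rfl
      exacts [hlow k hk', hzero]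
  · intro hdeg
    refine ⟨Polynomial.X_pow_dvd_iff.2 fun k hk => (hcoeff (by lia)).2 <|
      Polynomial.coeff_eq_zero_of_natDegree_lt (by lia), fun hdvd => ?_⟩
    have hzero := (hcoeff hm.le).1 (Polynomial.X_pow_dvd_iff.1 hdvd m m.lt_succ_self)
    rw [← hdeg, Polynomial.coeff_natDegree, Polynomial.leadingCoeff_eq_zero] at hzero
    rw [hzero, Polynomial.natDegree_zero] at hdeg
    lia

end Sylvester

section Height

variable {K : Type*} [Field K] {σ : Type*}

theorem isPrime_span_X_image (s : Set σ) :
    (Ideal.span (X '' s) : Ideal (MvPolynomial σ K)).IsPrime := by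
  classical
  set I : Ideal (MvPolynomial σ K) := Ideal.span (X '' s)
  let θ : MvPolynomial σ K →ₐ[K] MvPolynomial σ K := aeval fun i => if i ∈ s then 0 else X i
  have hmk : (Ideal.Quotient.mkₐ K I).comp θ = Ideal.Quotient.mkₐ K I := by
    refine algHom_ext fun i => ?_
    by_cases hi : i ∈ s
    · have hXi : Ideal.Quotient.mk I (X i) = 0 :=
        Ideal.Quotient.eq_zero_iff_mem.2 (Ideal.subset_span ⟨i, hi, rfl⟩)
      simp [θ, hi, hXi]
    · simp [θ, hi]
  have hker : I = RingHom.ker θ := by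
    refine le_antisymm (Ideal.span_le.2 ?_) fun p hp => Ideal.Quotient.eq_zero_iff_mem.1 ?_
    · rintro _ ⟨i, hi, rfl⟩
      simp [θ, hi]
    · calc Ideal.Quotient.mk I p = Ideal.Quotient.mk I (θ p) := (DFunLike.congr_fun hmk p).symm
        _ = 0 := by rw [RingHom.mem_ker.1 hp, map_zero]
  rw [hker]
  exact RingHom.ker_isPrime _

theorem X_mem_span_X_image_iff {s : Set σ} {i : σ} :
    (X i : MvPolynomial σ K) ∈ Ideal.span (X '' s) ↔ i ∈ s := by
  simp [mem_ideal_span_X_image, support_X, Finsupp.single_apply_eq_zero]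

theorem encard_le_height_span_X_image {s : Set σ} (hs : s.Finite) :
    s.encard ≤ (Ideal.span (X '' s) : Ideal (MvPolynomial σ K)).height := by
  induction s, hs using Set.Finite.induction_on with
  | empty => simp
  | @insert i s hi _ ih =>
    have := isPrime_span_X_image (K := K) s
    have := isPrime_span_X_image (K := K) (insert i s)
    rw [Set.encard_insert_of_notMem hi]
    refine (add_le_add_left ih 1).trans (Ideal.height_add_one_le_of_lt_of_isPrime ?_)
    refine lt_of_le_not_ge (Ideal.span_mono (Set.image_mono (Set.subset_insert i s))) fun hle => ?_
    exact hi <| X_mem_span_X_image_iff.1 <|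
      hle (X_mem_span_X_image_iff (K := K).2 (Set.mem_insert i s))

theorem height_span_X_image [Finite σ] (s : Set σ) :
    (Ideal.span (X '' s) : Ideal (MvPolynomial σ K)).height = s.encard := by
  refine le_antisymm ?_ (encard_le_height_span_X_image s.toFinite)
  have := isPrime_span_X_image (K := K) s
  refine (Ideal.height_le_card_of_mem_minimalPrimes_span (s := X '' s) (Set.toFinite _)
    (by rw [Ideal.minimalPrimes_eq_subsingleton_self]; rfl)).trans ?_
  rw [(Set.toFinite _).cast_ncard_eq]
  exact Set.encard_image_le _ _

variable {m : ℕ} {φ : Matrix (Fin 3) (Fin 2) (PlaneRing K)}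

theorem height_entryIdeal_ne_two_of_col_eq_X (hcol : φ.col 0 = X) : (entryIdeal φ).height ≠ 2 := by
  have hle : Ideal.span (X '' Set.univ) ≤ entryIdeal φ := by
    refine Ideal.span_le.2 ?_
    rintro _ ⟨i, -, rfl⟩
    exact Ideal.subset_span ⟨(i, 0), congrFun hcol i⟩
  have hheight := Ideal.height_mono hle
  rw [height_span_X_image, Set.encard_univ, ENat.card_eq_coe_fintype_card, Fintype.card_fin]
    at hheight
  exact (lt_of_lt_of_le (by norm_num) hheight).ne'

theorem SylvesterSteps.secondEquation_mem_axisIdeal (h : SylvesterSteps φ m) (hm : 0 < m) :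
    secondEquation φ ∈ axisIdeal K := by
  obtain ⟨F, hF₀, hstep, -⟩ := h.1
  obtain ⟨a, b, hab, -⟩ := hstep 0 hm
  rw [← hF₀, hab]
  exact Ideal.mem_span_pair.2 ⟨a, b, rfl⟩

theorem secondEquation_mem_axisIdeal_iff :
    secondEquation φ ∈ axisIdeal K ↔ ∀ i, φ i 1 ∈ Ideal.span (X '' {0, 1}) := by
  have hmap : axisIdeal K = Ideal.map C (Ideal.span (X '' {0, 1}) : Ideal (PlaneRing K)) := by
    rw [Ideal.map_span, Set.image_image, Set.image_pair, axisIdeal]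
  rw [hmap]
  refine ⟨fun hmem i => ?_, fun hmem => Ideal.sum_mem _ fun i _ =>
    Ideal.mul_mem_left _ _ (Ideal.mem_map_of_mem C (hmem i))⟩
  simpa [secondEquation, coeff_sum, coeff_X_mul', coeff_C, Finsupp.single_apply,
    Finset.sum_ite_eq] using mem_map_C_iff.1 hmem (Finsupp.single i 1)

theorem IsNormalForm.height_entryIdeal_eq_two (hφ : IsNormalForm φ)
    (hmem : secondEquation φ ∈ axisIdeal K) : (entryIdeal φ).height = 2 := by
  suffices hentry : entryIdeal φ = Ideal.span (X '' {0, 1}) by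
    rw [hentry, height_span_X_image, Set.encard_pair zero_ne_one]
  obtain ⟨h₀, h₁, h₂⟩ := hφ
  refine le_antisymm (Ideal.span_le.2 ?_) (Ideal.span_le.2 ?_)
  · rintro _ ⟨⟨i, k⟩, rfl⟩
    fin_cases k
    · fin_cases i <;> simp [h₀, h₁, h₂, X_mem_span_X_image_iff]
    · exact secondEquation_mem_axisIdeal_iff.1 hmem i
  · have hX₁ : -X 1 ∈ entryIdeal φ := Ideal.subset_span ⟨(1, 0), h₁⟩
    rintro _ ⟨j, rfl | rfl, rfl⟩
    exacts [Ideal.subset_span ⟨(0, 0), h₀⟩, neg_mem_iff.1 hX₁]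

end Height

section Coordinates

variable {K : Type*} [Field K] {d μ₁ μ₂ : ℕ} {f : Fin 3 → PlaneRing K}
  {φ : Matrix (Fin 3) (Fin 2) (PlaneRing K)}

theorem substSource_eq_bind₁ (A : GL (Fin 3) K) : substSource A = bind₁ A.val.toMvPolynomial := by
  simp only [substSource, C_mul_X_eq_monomial]
  rfl

theorem substSource_X (A : GL (Fin 3) K) (i : Fin 3) :
    substSource A (X i) = A.val.toMvPolynomial i := by
  rw [substSource_eq_bind₁, bind₁_X_right]

theorem substSource_toMvPolynomial (A : GL (Fin 3) K) (M : Matrix (Fin 3) (Fin 3) K) (i : Fin 3) :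
    substSource A (M.toMvPolynomial i) = (M * A.val).toMvPolynomial i := by
  rw [substSource_eq_bind₁, toMvPolynomial_mul]

theorem substSource_substSource (A B : GL (Fin 3) K) (p : PlaneRing K) :
    substSource A (substSource B p) = substSource (B * A) p := by
  have hcomp : (substSource A).comp (substSource B) = substSource (B * A) :=
    algHom_ext fun i => by
      rw [AlgHom.comp_apply, substSource_X, substSource_X, substSource_toMvPolynomial,
        Units.val_mul]
  rw [← hcomp, AlgHom.comp_apply]

theorem substSource_one : substSource (1 : GL (Fin 3) K) = AlgHom.id K _ :=
  algHom_ext fun i => by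
    rw [substSource_X, Units.val_one, toMvPolynomial_one, AlgHom.id_apply]

/-- The automorphism of the coordinate ring given by a linear change of coordinates. -/
noncomputable def substEquiv (A : GL (Fin 3) K) : PlaneRing K ≃ₐ[K] PlaneRing K :=
  AlgEquiv.ofAlgHom (substSource A) (substSource A⁻¹)
    (AlgHom.ext fun p => by
      rw [AlgHom.comp_apply, substSource_substSource, inv_mul_cancel, substSource_one])
    (AlgHom.ext fun p => by
      rw [AlgHom.comp_apply, substSource_substSource, mul_inv_cancel, substSource_one])

theorem substSource_bijective (A : GL (Fin 3) K) : Function.Bijective (substSource A) :=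
  (substEquiv A).bijective

theorem isHomogeneous_substSource (A : GL (Fin 3) K) {p : PlaneRing K} {n : ℕ}
    (hp : p.IsHomogeneous n) : (substSource A p).IsHomogeneous n := by
  rw [substSource_eq_bind₁, ← one_mul n]
  exact hp.aeval _ (toMvPolynomial_isHomogeneous A.val)

/-- The vector `P v(A x)`, obtained from a vector `v` of polynomials by the change of coordinates
`A` in the source and the constant matrix `P`. -/
noncomputable def transform (A P : GL (Fin 3) K) (v : Fin 3 → PlaneRing K) :
    Fin 3 → PlaneRing K :=
  fun i => ∑ j, C (P.val i j) * substSource A (v j)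

theorem col_changeCoords (A P : GL (Fin 3) K) (k : Fin 2) :
    (changeCoords A P φ).col k = transform A P (φ.col k) :=
  rfl

theorem transform_eq_mulVec (A P : GL (Fin 3) K) (v : Fin 3 → PlaneRing K) :
    transform A P v = P.val.map C *ᵥ (substSource A ∘ v) :=
  rfl

theorem transform_apply (A P : GL (Fin 3) K) (v : Fin 3 → PlaneRing K) (i : Fin 3) :
    transform A P v i = substSource A (aeval v (P.val.toMvPolynomial i)) := by
  simp [transform, toMvPolynomial, ← C_mul_X_eq_monomial, algebraMap_eq]

theorem transform_transform (A B P Q : GL (Fin 3) K) (v : Fin 3 → PlaneRing K) :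
    transform A P (transform B Q v) = transform (B * A) (P * Q) v := by
  have hsubst : substSource A ∘ transform B Q v =
      Q.val.map C *ᵥ (substSource (B * A) ∘ v) := by
    ext1 i
    simp [transform, mulVec, dotProduct, substSource_substSource]
  rw [transform_eq_mulVec, hsubst, mulVec_mulVec, ← Matrix.map_mul, ← Units.val_mul,
    transform_eq_mulVec]

theorem transform_one (v : Fin 3 → PlaneRing K) : transform 1 1 v = v := by
  ext1 i
  simp [transform_apply, substSource_one]

theorem transform_bijective (A P : GL (Fin 3) K) : Function.Bijective (transform A P) := by
  refine Function.bijective_iff_has_inverse.2 ⟨transform A⁻¹ P⁻¹, fun v => ?_, fun v => ?_⟩ <;>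
  simp [transform_transform, transform_one]

theorem aeval_transform (A P : GL (Fin 3) K) (p : PlaneRing K) :
    aeval (transform A P f) p = substSource A (aeval f (substSource P p)) := by
  rw [substSource_eq_bind₁ P, aeval_bind₁, comp_aeval_apply]
  exact congrArg (aeval · p) (funext (transform_apply A P f))

theorem isHomogeneous_transform {v : Fin 3 → PlaneRing K} (hv : ∀ i, (v i).IsHomogeneous d)
    (A P : GL (Fin 3) K) (i : Fin 3) : (transform A P v i).IsHomogeneous d :=
  IsHomogeneous.sum _ _ _ fun j _ => (isHomogeneous_substSource A (hv j)).C_mul _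

theorem IsDominant.transform (h : IsDominant f) (A P : GL (Fin 3) K) :
    IsDominant (transform A P f) := by
  intro p q hpq
  simp only [aeval_transform] at hpq
  exact (substSource_bijective P).1 (h ((substSource_bijective A).1 hpq))

theorem IsBirational.transform (h : IsBirational f) (hf : ∀ i, (f i).IsHomogeneous d)
    (A P : GL (Fin 3) K) : IsBirational (transform A P f) := by
  obtain ⟨hdom, e, g, hg, ⟨D, hD, hgf⟩, -⟩ := h
  refine (hdom.transform A P).isBirational (isHomogeneous_transform hf A P)
    (isHomogeneous_transform hg P⁻¹ A⁻¹) (D := substSource A D)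
    ((map_ne_zero_iff _ (substSource_bijective A).1).2 hD) fun i => ?_
  have hgf' : (fun j => aeval f (g j)) = D • X := funext hgf
  rw [aeval_transform, transform_apply, substSource_substSource, inv_mul_cancel, substSource_one,
    AlgHom.id_apply, comp_aeval_apply g (aeval f), hgf',
    aeval_smul_of_isHomogeneous (toMvPolynomial_isHomogeneous _ i), aeval_X_left_apply, pow_one,
    map_mul, substSource_toMvPolynomial, ← Units.val_mul, inv_mul_cancel, Units.val_one,
    toMvPolynomial_one]

theorem isBirational_transform_iff (hf : ∀ i, (f i).IsHomogeneous d) (A P : GL (Fin 3) K) :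
    IsBirational (transform A P f) ↔ IsBirational f := by
  refine ⟨fun h => ?_, fun h => h.transform hf A P⟩
  have hinv := h.transform (isHomogeneous_transform hf A P) A⁻¹ P⁻¹
  rwa [transform_transform, mul_inv_cancel, inv_mul_cancel, transform_one] at hinv

/-- The inverse transpose of `P`: when the columns of the presentation matrix are multiplied by `P`,
the row of forms must be multiplied by `P⁻¹` on the right. -/
noncomputable def invTranspose (P : GL (Fin 3) K) : GL (Fin 3) K where
  val := P⁻¹.valᵀ
  inv := P.valᵀ
  val_inv := by rw [← transpose_mul, ← Units.val_mul, mul_inv_cancel, Units.val_one, transpose_one]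
  inv_val := by rw [← transpose_mul, ← Units.val_mul, inv_mul_cancel, Units.val_one, transpose_one]

theorem transform_invTranspose_dotProduct (A P : GL (Fin 3) K) (v w : Fin 3 → PlaneRing K) :
    transform A (invTranspose P) v ⬝ᵥ transform A P w = substSource A (v ⬝ᵥ w) := by
  have hP : P⁻¹.val.map (C : K → PlaneRing K) * P.val.map C = 1 := by
    rw [← Matrix.map_mul, ← Units.val_mul, inv_mul_cancel, Units.val_one,
      Matrix.map_one _ (map_zero _) (map_one _)]
  have hvec : transform A (invTranspose P) v = (substSource A ∘ v) ᵥ* P⁻¹.val.map C := by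
    rw [transform_eq_mulVec, invTranspose, transpose_map, mulVec_transpose]
  rw [hvec, transform_eq_mulVec, dotProduct_mulVec, vecMul_vecMul, hP, vecMul_one]
  simp [dotProduct]

theorem changeCoords_mulVec (A P : GL (Fin 3) K) (u : Fin 2 → PlaneRing K) :
    changeCoords A P φ *ᵥ (substSource A ∘ u) = transform A P (φ *ᵥ u) := by
  ext1 i
  simp only [mulVec, dotProduct, changeCoords, transform, of_apply, Function.comp_apply, map_sum,
    map_mul, Finset.sum_mul, Finset.mul_sum, mul_assoc]
  exact Finset.sum_comm

theorem isHilbertBurch_changeCoords (h : IsHilbertBurch f d μ₁ μ₂ φ) (A P : GL (Fin 3) K) :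
    IsHilbertBurch (transform A (invTranspose P) f) d μ₁ μ₂ (changeCoords A P φ) where
  sum_eq := h.sum_eq
  le := h.le
  homogeneous₁ := isHomogeneous_transform h.homogeneous₁ A P
  homogeneous₂ := isHomogeneous_transform h.homogeneous₂ A P
  injective u u' huu' := by
    obtain ⟨w, rfl⟩ := (substSource_bijective A).2.comp_left u
    obtain ⟨w', rfl⟩ := (substSource_bijective A).2.comp_left u'
    simp only [changeCoords_mulVec] at huu'
    rw [h.injective ((transform_bijective A P).1 huu')]
  exact v := by
    obtain ⟨w, rfl⟩ := (transform_bijective A P).2 v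
    have hiff : f ⬝ᵥ w = 0 ↔ ∃ u, φ *ᵥ u = w := h.exact w
    change _ ⬝ᵥ _ = 0 ↔ _
    rw [transform_invTranspose_dotProduct, map_eq_zero_iff _ (substSource_bijective A).1, hiff]
    refine Iff.trans (exists_congr fun u => ?_) (substSource_bijective A).2.comp_left.exists.symm
    rw [changeCoords_mulVec, (transform_bijective A P).1.eq_iff]

theorem entryIdeal_changeCoords_le (A P : GL (Fin 3) K) :
    entryIdeal (changeCoords A P φ) ≤ (entryIdeal φ).map (substSource A) := by
  refine Ideal.span_le.2 ?_
  rintro _ ⟨⟨i, k⟩, rfl⟩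
  have hentry (j : Fin 3) : φ j k ∈ entryIdeal φ := Ideal.subset_span ⟨(j, k), rfl⟩
  exact Ideal.sum_mem (t := Finset.univ) _ fun j _ =>
    Ideal.mul_mem_left _ (C (P.val i j)) (Ideal.mem_map_of_mem (substSource A) (hentry j))

theorem height_entryIdeal_changeCoords_le (A P : GL (Fin 3) K) :
    (entryIdeal (changeCoords A P φ)).height ≤ (entryIdeal φ).height :=
  (Ideal.height_mono (entryIdeal_changeCoords_le A P)).trans_eq
    (RingEquiv.height_map (substEquiv A).toRingEquiv _)

theorem changeCoords_inv (A P : GL (Fin 3) K) :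
    changeCoords A⁻¹ P⁻¹ (changeCoords A P φ) = φ := by
  refine Matrix.ext_col fun k => ?_
  rw [col_changeCoords, col_changeCoords, transform_transform, mul_inv_cancel, inv_mul_cancel,
    transform_one]

theorem height_entryIdeal_changeCoords (A P : GL (Fin 3) K) :
    (entryIdeal (changeCoords A P φ)).height = (entryIdeal φ).height := by
  refine le_antisymm (height_entryIdeal_changeCoords_le A P) ?_
  simpa only [changeCoords_inv] using
    height_entryIdeal_changeCoords_le (φ := changeCoords A P φ) A⁻¹ P⁻¹

end Coordinates

section ColumnOfLinearForms

variable {K : Type*} [Field K] {d μ₂ : ℕ} {f : Fin 3 → PlaneRing K}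
  {φ : Matrix (Fin 3) (Fin 2) (PlaneRing K)}

theorem exists_mul_mul_eq_of_rank_eq {n : Type*} [Fintype n] [DecidableEq n] {M N : Matrix n n K}
    (h : M.rank = N.rank) : ∃ P Q : GL n K, P.val * M * Q.val = N := by
  have hnormal := exists_rank_normal_form N
  rw [← h] at hnormal
  obtain ⟨V', U', e', hV', hU', hN⟩ := hnormal
  obtain ⟨V, U, e, hV, hU, hM⟩ := exists_rank_normal_form M
  let τ : n ≃ n := e'.trans e.symm
  have hVτ : IsUnit (V.submatrix τ id) := (isUnit_submatrix_equiv τ (.refl n)).2 hV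
  have hUτ : IsUnit (U.submatrix id τ) := (isUnit_submatrix_equiv (.refl n) τ).2 hU
  have hMN : V.submatrix τ id * M * U.submatrix id τ = V' * N * U' := by
    change (V * M * U).submatrix τ τ = _
    rw [hM, hN, submatrix_submatrix]
    congr 1 <;> ext1 i <;> simp [τ]
  refine ⟨hV'.unit⁻¹ * hVτ.unit, hUτ.unit * hU'.unit⁻¹, ?_⟩
  calc ((hV'.unit⁻¹ * hVτ.unit : GL n K) : Matrix n n K) * M * (hUτ.unit * hU'.unit⁻¹ : GL n K)
      = (hV'.unit⁻¹ : GL n K) *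
          (V.submatrix τ id * M * U.submatrix id τ) *
          (hU'.unit⁻¹ : GL n K) := by
        simp only [Units.val_mul, IsUnit.unit_spec, Matrix.mul_assoc]
    _ = ((hV'.unit⁻¹ * hV'.unit : GL n K) : Matrix n n K) * N *
          (hU'.unit * hU'.unit⁻¹ : GL n K) := by
        rw [hMN]
        simp only [Units.val_mul, IsUnit.unit_spec, Matrix.mul_assoc]
    _ = N := by simp

theorem exists_toMvPolynomial_eq {ι σ : Type*} [Fintype σ] {l : ι → MvPolynomial σ K}
    (hl : ∀ i, (l i).IsHomogeneous 1) : ∃ B : Matrix ι σ K, B.toMvPolynomial = l := by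
  have hspan (i : ι) : ∃ b : σ → K, ∑ j, b j • X j = l i := by
    rw [← Submodule.mem_span_range_iff_exists_fun, ← homogeneousSubmodule_one_eq_span_X]
    exact hl i
  choose B hB using hspan
  refine ⟨B, funext fun i => ?_⟩
  simp [← hB, toMvPolynomial, smul_eq_C_mul, C_mul_X_eq_monomial]

theorem IsHilbertBurch.col_zero_ne_zero (h : IsHilbertBurch f d 1 μ₂ φ) : φ.col 0 ≠ 0 := by
  intro hcol
  have hker : φ *ᵥ Pi.single 0 1 = φ *ᵥ 0 := by rw [mulVec_single_one, hcol, mulVec_zero]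
  simpa using congrFun (h.injective hker) 0

theorem exists_eq_vecMulVec_of_rank_le_one {ι σ : Type*} [Fintype σ] {B : Matrix ι σ K}
    (hB : B.rank ≤ 1) : ∃ (b : ι → K) (c : σ → K), B = vecMulVec b c := by
  classical
  obtain ⟨⟨b, _⟩, hb⟩ := finrank_le_one_iff.1 hB
  choose c hc using fun j : σ => hb ⟨B.col j, Pi.single j 1, by simp⟩
  refine ⟨b, c, Matrix.ext fun i j => ?_⟩
  simpa [vecMulVec_apply, mul_comm] using (congrFun (congrArg Subtype.val (hc j)) i).symm

theorem IsHilbertBurch.two_le_rank (h : IsHilbertBurch f d 1 μ₂ φ) (hdom : IsDominant f)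
    {B : Matrix (Fin 3) (Fin 3) K} (hB : φ.col 0 = B.toMvPolynomial) : 2 ≤ B.rank := by
  by_contra! hrank
  obtain ⟨b, c, rfl⟩ := exists_eq_vecMulVec_of_rank_le_one (Nat.lt_succ_iff.1 hrank)
  have hcol : φ.col 0 = fun i => b i • ∑ j, c j • (X j : PlaneRing K) := by
    rw [hB]
    ext1 i
    simp [toMvPolynomial, vecMulVec_apply, Finset.mul_sum, ← C_mul_X_eq_monomial, smul_eq_C_mul,
      mul_assoc]
  have hprod : (∑ i, b i • f i) * ∑ j, c j • (X j : PlaneRing K) = 0 := by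
    rw [← h.dotProduct_col 0, hcol, dotProduct, Finset.sum_mul]
    simp only [smul_mul_assoc, mul_smul_comm]
  refine h.col_zero_ne_zero (hcol.trans (funext fun i => ?_))
  rcases mul_eq_zero.1 hprod with hf | hX
  · rw [Fintype.linearIndependent_iff.1 hdom.linearIndependent b hf i, zero_smul, Pi.zero_apply]
  · rw [hX, smul_zero, Pi.zero_apply]

theorem transform_toMvPolynomial (A P : GL (Fin 3) K) (B : Matrix (Fin 3) (Fin 3) K) :
    transform A P B.toMvPolynomial = (P.val * B * A.val).toMvPolynomial := by
  ext1 i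
  rw [transform_apply, ← substSource_toMvPolynomial, toMvPolynomial_mul]
  rfl

theorem isNormalForm_of_col_eq
    (hcol : φ.col 0 = (diagonal ![(1 : K), -1, 0]).toMvPolynomial) : IsNormalForm φ := by
  have hentry (i : Fin 3) : φ i 0 = C (![(1 : K), -1, 0] i) * X i := by
    change φ.col 0 i = _
    rw [hcol]
    simp [toMvPolynomial, diagonal_apply, ← C_mul_X_eq_monomial, apply_ite (C (σ := Fin 3))]
  exact ⟨by simp [hentry], by simp [hentry], by simp [hentry]⟩

theorem rank_diagonal_one_neg_one_zero : (diagonal ![(1 : K), -1, 0]).rank = 2 := by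
  classical
  rw [rank_diagonal, Fintype.card_subtype]
  simp [Fin.univ_succ, Finset.filter_insert]

theorem IsHilbertBurch.exists_changeCoords (h : IsHilbertBurch f d 1 μ₂ φ) (hdom : IsDominant f) :
    ∃ A P : GL (Fin 3) K, (changeCoords A P φ).col 0 = X ∨ IsNormalForm (changeCoords A P φ) := by
  obtain ⟨B, hB⟩ := exists_toMvPolynomial_eq h.homogeneous₁
  have hcol {N : Matrix (Fin 3) (Fin 3) K} (hrank : B.rank = N.rank) :
      ∃ A P : GL (Fin 3) K, (changeCoords A P φ).col 0 = N.toMvPolynomial := by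
    obtain ⟨P, A, rfl⟩ := exists_mul_mul_eq_of_rank_eq hrank
    exact ⟨A, P, by rw [← transform_toMvPolynomial, hB]; rfl⟩
  have htwo : 2 ≤ B.rank := h.two_le_rank hdom hB.symm
  have hthree : B.rank ≤ 3 := B.rank_le_width
  obtain hrank | hrank : B.rank = 2 ∨ B.rank = 3 := by lia
  · obtain ⟨A, P, hN⟩ := hcol (hrank.trans rank_diagonal_one_neg_one_zero.symm)
    exact ⟨A, P, Or.inr (isNormalForm_of_col_eq hN)⟩
  · obtain ⟨A, P, hN⟩ := hcol (N := 1) (by rw [hrank, rank_one, Fintype.card_fin])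
    exact ⟨A, P, Or.inl (hN.trans toMvPolynomial_one)⟩

end ColumnOfLinearForms

section Criterion

variable {K : Type*} [Field K] {d m μ₂ : ℕ} {f : Fin 3 → PlaneRing K}
  {φ : Matrix (Fin 3) (Fin 2) (PlaneRing K)}

theorem IsHilbertBurch.isBirational_iff_sylvesterSteps (h : IsHilbertBurch f d 1 μ₂ φ)
    (hf : ∀ i, (f i).IsHomogeneous d) (hdom : IsDominant f) (hφ : IsNormalForm φ) :
    IsBirational f ↔ SylvesterSteps φ (μ₂ - 1) := by
  have hμ : 1 ≤ μ₂ := h.le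
  rw [sylvesterSteps_iff_natDegree_fiberPolynomial h.homogeneous₂ (by lia), Nat.sub_sub_self hμ]
  exact ⟨fun hbir => h.natDegree_fiberPolynomial_eq_one hbir hφ,
    h.isBirational_of_natDegree_fiberPolynomial hf hdom hφ⟩

theorem IsHilbertBurch.isBirational_iff_sylvesterSteps_changeCoords
    (h : IsHilbertBurch f d 1 μ₂ φ) (hf : ∀ i, (f i).IsHomogeneous d) (hdom : IsDominant f)
    {A P : GL (Fin 3) K} (hN : IsNormalForm (changeCoords A P φ)) :
    IsBirational f ↔ SylvesterSteps (changeCoords A P φ) (μ₂ - 1) := by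
  rw [← isBirational_transform_iff hf A (invTranspose P)]
  exact (isHilbertBurch_changeCoords h A P).isBirational_iff_sylvesterSteps
    (isHomogeneous_transform hf _ _) (hdom.transform _ _) hN

theorem height_entryIdeal_eq_two_of_sylvesterSteps {A P : GL (Fin 3) K}
    (hN : IsNormalForm (changeCoords A P φ)) (hm : 0 < m)
    (hs : SylvesterSteps (changeCoords A P φ) m) : (entryIdeal φ).height = 2 := by
  rw [← height_entryIdeal_changeCoords A P]
  exact hN.height_entryIdeal_eq_two (hs.secondEquation_mem_axisIdeal hm)

theorem height_entryIdeal_ne_two_of_col_changeCoords_eq_X {A P : GL (Fin 3) K}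
    (hcol : (changeCoords A P φ).col 0 = X) : (entryIdeal φ).height ≠ 2 := by
  rw [← height_entryIdeal_changeCoords A P]
  exact height_entryIdeal_ne_two_of_col_eq_X hcol

theorem IsHilbertBurch.not_isBirational_of_col_changeCoords_eq_X (h : IsHilbertBurch f d 1 μ₂ φ)
    (hμ : 2 ≤ μ₂) (hf : ∀ i, (f i).IsHomogeneous d) {A P : GL (Fin 3) K}
    (hcol : (changeCoords A P φ).col 0 = X) : ¬ IsBirational f := by
  rw [← isBirational_transform_iff hf A (invTranspose P)]
  exact (isHilbertBurch_changeCoords h A P).not_isBirational_of_col_eq_X hμ hcol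

end Criterion

end PlaneMap

/-- The last condition is stated both for some and for every linear change of coordinates that
brings the first column of `φ` to the form `(x₀, -x₁, 0)`. -/
theorem mainTheorem12 {K : Type*} [Field K] (d μ₁ μ₂ : ℕ) (hd : 3 ≤ d)
    (f : Fin 3 → PlaneRing K) (hf : ∀ i, (f i).IsHomogeneous d)
    (hdom : PlaneMap.IsDominant f)
    (hdim : ringKrullDim (PlaneRing K ⧸ PlaneMap.baseIdeal f) = 1)
    (hsat : PlaneMap.IsSaturated (PlaneMap.baseIdeal f))
    (φ : Matrix (Fin 3) (Fin 2) (PlaneRing K))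
    (hφ : PlaneMap.IsHilbertBurch f d μ₁ μ₂ φ) (hμ : μ₁ = 1) :
    (PlaneMap.IsBirational f ↔
      (PlaneMap.entryIdeal φ).height = 2 ∧
        ∃ A P : GL (Fin 3) K, PlaneMap.IsNormalForm (PlaneMap.changeCoords A P φ) ∧
          PlaneMap.SylvesterSteps (PlaneMap.changeCoords A P φ) (d - 2)) ∧
    (PlaneMap.IsBirational f ↔
      (PlaneMap.entryIdeal φ).height = 2 ∧
        ∀ A P : GL (Fin 3) K, PlaneMap.IsNormalForm (PlaneMap.changeCoords A P φ) →
          PlaneMap.SylvesterSteps (PlaneMap.changeCoords A P φ) (d - 2)) := by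
  subst hμ
  have hsum : 1 + μ₂ = d := hφ.sum_eq
  have hbir {A P : GL (Fin 3) K} (hN : PlaneMap.IsNormalForm (PlaneMap.changeCoords A P φ)) :
      PlaneMap.IsBirational f ↔ PlaneMap.SylvesterSteps (PlaneMap.changeCoords A P φ) (d - 2) := by
    rw [← hsum, Nat.add_comm, Nat.add_sub_add_right μ₂ 1 1]
    exact hφ.isBirational_iff_sylvesterSteps_changeCoords hf hdom hN
  have hsteps : 0 < d - 2 := Nat.sub_pos_of_lt hd
  obtain ⟨A, P, hcol | hN⟩ := hφ.exists_changeCoords hdom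
  · have hnot : ¬ PlaneMap.IsBirational f :=
      hφ.not_isBirational_of_col_changeCoords_eq_X (by lia) hf hcol
    have hheight : (PlaneMap.entryIdeal φ).height ≠ 2 :=
      PlaneMap.height_entryIdeal_ne_two_of_col_changeCoords_eq_X hcol
    exact ⟨iff_of_false hnot fun h => hheight h.1, iff_of_false hnot fun h => hheight h.1⟩
  · have hheight (h : PlaneMap.IsBirational f) : (PlaneMap.entryIdeal φ).height = 2 :=
      PlaneMap.height_entryIdeal_eq_two_of_sylvesterSteps hN hsteps ((hbir hN).1 h)
    exact ⟨⟨fun h => ⟨hheight h, A, P, hN, (hbir hN).1 h⟩,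
        fun ⟨_, _, _, hN', hs⟩ => (hbir hN').2 hs⟩,
      ⟨fun h => ⟨hheight h, fun _ _ hN' => (hbir hN').1 h⟩,
        fun ⟨_, hall⟩ => (hbir hN).2 (hall A P hN)⟩⟩
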